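/- **Definitions.** A *t-norm* is a commutative, associative map $T:[0,1]^2\to[0,1]$, monotone in each variable, with $T(x,1)=x$; its dual t-conorm is $S(x,y)=1-T(1-x,1-y)$. Put $u_T^{(0)}=1$, $u_S^{(0)}=0$, and for $m\ge 1$ let $u_T^{(m)}=T(u,\dots,u)$ and $u_S^{(m)}=S(u,\dots,u)$ ($m$ arguments, iterated by associativity). For integers $p\ge1$, $q\ge0$ and real $t>0$ put $$u_T^{(1/p)}=\sup\{v\in[0,1]: v_T^{(p)}<u\},\quad u_T^{(q/p)}=\bigl(u_T^{(1/p)}\bigr)_T^{(q)},\quad u_T^{(t)}=\inf\{u_T^{(r)}: r\in[0,t]\cap\mathbb Q\},$$ $$u_S^{(1/p)}=\inf\{v\in[0,1]: v_S^{(p)}>u\},\quad u_S^{(q/p)}=\bigl(u_S^{(1/p)}\bigr)_S^{(q)},\quad u_S^{(t)}=\sup\{u_S^{(r)}: r\in[0,t]\cap\mathbb Q\},$$ where suprema and infima are taken in $[0,1]$ (so $\sup\varnothing=0$, $\inf\varnothing=1$) and $q/p$ is in lowest terms. An *intuitionistic fuzzy value* (IFV) is a pair $\alpha=\langle\mu_\alpha,\nu_\alpha\rangle\in[0,1]^2$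 with $\mu_\alpha+\nu_\alpha\le1$. For IFVs $\alpha,\beta$ and $\lambda>0$ put $$\alpha\oplus_T\beta=\langle S(\mu_\alpha,\mu_\beta),T(\nu_\alpha,\nu_\beta)\rangle,\qquad \alpha\otimes_T\beta=\langle T(\mu_\alpha,\mu_\beta),S(\nu_\alpha,\nu_\beta)\rangle,$$ $$\lambda_T\alpha=\langle(\mu_\alpha)_S^{(\lambda)},(\nu_\alpha)_T^{(\lambda)}\rangle,\qquad \alpha^{\lambda_T}=\langle(\mu_\alpha)_T^{(\lambda)},(\nu_\alpha)_S^{(\lambda)}\rangle;$$ these are again IFVs. Write $\alpha\le\beta$ if $\mu_\alpha\le\mu_\beta$ and $\nu_\alpha\ge\nu_\beta$. Write $\alpha\le_{\mathrm{Xu}}\beta$ if $\alpha=\beta$, or $\mu_\alpha-\nu_\alpha<\mu_\beta-\nu_\beta$, or $\mu_\alpha-\nu_\alpha=\mu_\beta-\nu_\beta$ and $\mu_\alpha+\nu_\alpha<\mu_\beta+\nu_\beta$. **Proposition.** Let $T$ be a continuous t-norm, $n\ge1$, and $\Omega=(\omega_1,\dots,\omega_n)$ with $\omega_\ell\in(0,1]$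 and $\sum_{\ell=1}^n\omega_\ell=1$. For IFVs $\gamma_1,\dots,\gamma_n$ let $$\mathrm{IFWA}_{T,\Omega}(\gamma_1,\dots,\gamma_n)=((\omega_1)_T\gamma_1)\oplus_T\cdots\oplus_T((\omega_n)_T\gamma_n),\qquad \mathrm{IFWG}_{T,\Omega}(\gamma_1,\dots,\gamma_n)=(\gamma_1^{(\omega_1)_T})\otimes_T\cdots\otimes_T(\gamma_n^{(\omega_n)_T}).$$ Then: 1. (Idempotency) If $\gamma_1=\cdots=\gamma_n=\gamma$, then $\mathrm{IFWA}_{T,\Omega}(\gamma_1,\dots,\gamma_n)=\mathrm{IFWG}_{T,\Omega}(\gamma_1,\dots,\gamma_n)=\gamma$. 2. (Boundedness) With the IFVs $\gamma^-=\langle\min_j\mu_{\gamma_j},\max_j\nu_{\gamma_j}\rangle$ and $\gamma^+=\langle\max_j\mu_{\gamma_j},\min_j\nu_{\gamma_j}\rangle$, both for $\le$ and for $\le_{\mathrm{Xu}}$, each of $\mathrm{IFWA}_{T,\Omega}(\gamma_1,\dots,\gamma_n)$ and $\mathrm{IFWG}_{T,\Omega}(\gamma_1,\dots,\gamma_n)$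 lies between $\gamma^-$ and $\gamma^+$. 3. (Monotonicity) If $\beta_1,\dots,\beta_n$ are IFVs with $\mu_{\beta_j}\ge\mu_{\gamma_j}$ and $\nu_{\beta_j}\le\nu_{\gamma_j}$ for all $j$, then $$\mathrm{IFWA}_{T,\Omega}(\gamma_1,\dots,\gamma_n)\le_{\mathrm{Xu}}\mathrm{IFWA}_{T,\Omega}(\beta_1,\dots,\beta_n),\qquad \mathrm{IFWG}_{T,\Omega}(\gamma_1,\dots,\gamma_n)\le_{\mathrm{Xu}}\mathrm{IFWG}_{T,\Omega}(\beta_1,\dots,\beta_n).$$ -/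

import Mathlib

open scoped unitInterval NNRat

noncomputable section

/-- A triangular norm on `[0, 1]`. -/
structure TNorm where
  op : I → I → I
  comm : ∀ x y, op x y = op y x
  assoc : ∀ x y z, op x (op y z) = op (op x y) z
  mono : ∀ x y z, x ≤ y → op x z ≤ op y z
  neutral : ∀ x, op x 1 = x

/-- A triangular conorm on `[0, 1]`. -/
structure TConorm where
  op : I → I → I
  comm : ∀ x y, op x y = op y x
  assoc : ∀ x y z, op x (op y z) = op (op x y) z
  mono : ∀ x y z, x ≤ y → op x z ≤ op y z
  neutral : ∀ x, op x 0 = x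

namespace TNorm

/-- `T` is continuous as a function of two variables. -/
def IsContinuous (T : TNorm) : Prop := Continuous fun p : I × I => T.op p.1 p.2

/-- The dual t-conorm `S(x, y) = 1 - T(1 - x, 1 - y)`; `σ x` is `1 - x`. -/
def dual (T : TNorm) : TConorm where
  op x y := σ (T.op (σ x) (σ y))
  comm x y := by rw [T.comm]
  assoc x y z := by simp [T.assoc]
  mono x y z h := by
    rw [unitInterval.symm_le_symm]
    exact T.mono _ _ _ (unitInterval.symm_le_symm.2 h)
  neutral x := by simp [T.neutral]

/-- The power with exponent a natural number: `1` for the exponent `0`, and `T(x, …, x)` with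
`m` arguments for the exponent `m ≥ 1` (note that `T(1, x) = x`). -/
def natPow (T : TNorm) (x : I) : ℕ → I
  | 0 => 1
  | m + 1 => T.op (T.natPow x m) x

/-- The `p`-th root `sup {v | v ^ p < u}`, the supremum being taken in `[0, 1]`. -/
def root (T : TNorm) (p : ℕ) (u : I) : I := sSup {v : I | T.natPow v p < u}

/-- The power with exponent `q / p` (in lowest terms): the `q`-th power of the `p`-th root. -/
def ratPow (T : TNorm) (u : I) (r : ℚ≥0) : I := T.natPow (T.root r.den u) r.num

/-- The power with real exponent `t > 0`: the infimum in `[0, 1]` of the rational powers with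
exponents in `[0, t]`. -/
def pow (T : TNorm) (u : I) (t : ℝ) : I := sInf {x : I | ∃ r : ℚ≥0, (r : ℝ) ≤ t ∧ x = T.ratPow u r}

end TNorm

namespace TConorm

/-- The power with exponent a natural number: `0` for the exponent `0`, and `S(x, …, x)` with
`m` arguments for the exponent `m ≥ 1` (note that `S(0, x) = x`). -/
def natPow (S : TConorm) (x : I) : ℕ → I
  | 0 => 0
  | m + 1 => S.op (S.natPow x m) x

/-- The `p`-th root `inf {v | v ^ p > u}`, the infimum being taken in `[0, 1]`. -/
def root (S : TConorm) (p : ℕ) (u : I) : I := sInf {v : I | u < S.natPow v p}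

/-- The power with exponent `q / p` (in lowest terms): the `q`-th power of the `p`-th root. -/
def ratPow (S : TConorm) (u : I) (r : ℚ≥0) : I := S.natPow (S.root r.den u) r.num

/-- The power with real exponent `t > 0`: the supremum in `[0, 1]` of the rational powers with
exponents in `[0, t]`. -/
def pow (S : TConorm) (u : I) (t : ℝ) : I := sSup {x : I | ∃ r : ℚ≥0, (r : ℝ) ≤ t ∧ x = S.ratPow u r}

end TConorm

/-! Facts that are needed for the operations on intuitionistic fuzzy values to be well defined. -/

namespace TNorm

theorem op_le_op (T : TNorm) {x x' y y' : I} (hx : x ≤ x') (hy : y ≤ y') :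
    T.op x y ≤ T.op x' y' := by
  refine (T.mono _ _ _ hx).trans ?_
  rw [T.comm x' y, T.comm x' y']
  exact T.mono _ _ _ hy

theorem natPow_mono (T : TNorm) {x y : I} (h : x ≤ y) (m : ℕ) : T.natPow x m ≤ T.natPow y m := by
  induction m with
  | zero => exact le_rfl
  | succ m ih => exact T.op_le_op ih h

theorem root_mono (T : TNorm) {x y : I} (h : x ≤ y) (p : ℕ) : T.root p x ≤ T.root p y :=
  sSup_le_sSup fun _ hv => lt_of_lt_of_le hv h

theorem pow_mono (T : TNorm) {x y : I} (h : x ≤ y) (t : ℝ) : T.pow x t ≤ T.pow y t := by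
  refine le_sInf ?_
  rintro _ ⟨r, hr, rfl⟩
  exact le_trans (sInf_le (show T.ratPow x r ∈ _ from ⟨r, hr, rfl⟩))
    (T.natPow_mono (T.root_mono h _) _)

theorem dual_natPow (T : TNorm) (x : I) (m : ℕ) : T.dual.natPow x m = σ (T.natPow (σ x) m) := by
  induction m with
  | zero => simp [natPow, TConorm.natPow]
  | succ m ih =>
    rw [TConorm.natPow, natPow, ih]
    simp [dual]

theorem dual_root (T : TNorm) (p : ℕ) (u : I) : T.dual.root p u = σ (T.root p (σ u)) := by
  apply le_antisymm
  · rw [unitInterval.le_symm_comm]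
    refine sSup_le fun v hv => ?_
    rw [unitInterval.le_symm_comm]
    refine sInf_le ?_
    simpa [dual_natPow, unitInterval.lt_symm_comm] using hv
  · refine le_sInf fun v hv => ?_
    rw [unitInterval.symm_le_comm]
    refine le_sSup ?_
    simpa [dual_natPow, unitInterval.lt_symm_comm] using hv

theorem dual_ratPow (T : TNorm) (u : I) (r : ℚ≥0) :
    T.dual.ratPow u r = σ (T.ratPow (σ u) r) := by
  simp [ratPow, TConorm.ratPow, dual_natPow, dual_root]

theorem dual_pow_le (T : TNorm) (u : I) (t : ℝ) : T.dual.pow u t ≤ σ (T.pow (σ u) t) := by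
  refine sSup_le ?_
  rintro _ ⟨r, hr, rfl⟩
  rw [dual_ratPow, unitInterval.symm_le_symm]
  exact sInf_le ⟨r, hr, rfl⟩

end TNorm

theorem add_le_one_iff_le_symm (x y : I) : (x : ℝ) + y ≤ 1 ↔ x ≤ σ y := by
  rw [← Subtype.coe_le_coe, unitInterval.coe_symm_eq, le_sub_iff_add_le]

/-- An intuitionistic fuzzy value: a pair `⟨μ, ν⟩` in `[0, 1]²` with `μ + ν ≤ 1`. -/
@[ext]
structure IFV where
  mu : I
  nu : I
  add_le_one : (mu : ℝ) + nu ≤ 1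

namespace IFV

/-- The score degree `μ - ν`. -/
def score (α : IFV) : ℝ := (α.mu : ℝ) - α.nu

/-- The accuracy degree `μ + ν`. -/
def accuracy (α : IFV) : ℝ := (α.mu : ℝ) + α.nu

/-- Strict Xu order. -/
def XuLT (α β : IFV) : Prop :=
  α.score < β.score ∨ (α.score = β.score ∧ α.accuracy < β.accuracy)

/-- The total order `≤_Xu` of Xu and Yager. -/
def XuLE (α β : IFV) : Prop := α.XuLT β ∨ α = β

/-- The componentwise partial order: smaller membership and larger non-membership. -/
def CompLE (α β : IFV) : Prop := α.mu ≤ β.mu ∧ β.nu ≤ α.nu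

/-- `α ⊕_T β = ⟨S(μ_α, μ_β), T(ν_α, ν_β)⟩`, with `S` the dual of `T`. -/
def oplus (T : TNorm) (α β : IFV) : IFV where
  mu := T.dual.op α.mu β.mu
  nu := T.op α.nu β.nu
  add_le_one := by
    rw [add_le_one_iff_le_symm]
    refine unitInterval.symm_le_symm.2 (T.op_le_op ?_ ?_)
    · rw [unitInterval.le_symm_comm, ← add_le_one_iff_le_symm]; exact α.add_le_one
    · rw [unitInterval.le_symm_comm, ← add_le_one_iff_le_symm]; exact β.add_le_one

/-- `α ⊗_T β = ⟨T(μ_α, μ_β), S(ν_α, ν_β)⟩`, with `S` the dual of `T`. -/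
def otimes (T : TNorm) (α β : IFV) : IFV where
  mu := T.op α.mu β.mu
  nu := T.dual.op α.nu β.nu
  add_le_one := by
    rw [add_le_one_iff_le_symm, unitInterval.le_symm_comm]
    refine unitInterval.symm_le_symm.2 (T.op_le_op ?_ ?_)
    · rw [← add_le_one_iff_le_symm]; exact α.add_le_one
    · rw [← add_le_one_iff_le_symm]; exact β.add_le_one

/-- `l_T α = ⟨(μ_α)_S^(l), (ν_α)_T^(l)⟩` for `l > 0`. -/
def smulT (T : TNorm) (l : ℝ) (α : IFV) : IFV where
  mu := T.dual.pow α.mu l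
  nu := T.pow α.nu l
  add_le_one := by
    rw [add_le_one_iff_le_symm]
    refine (T.dual_pow_le _ _).trans (unitInterval.symm_le_symm.2 (T.pow_mono ?_ l))
    rw [unitInterval.le_symm_comm, ← add_le_one_iff_le_symm]; exact α.add_le_one

/-- `α^(l_T) = ⟨(μ_α)_T^(l), (ν_α)_S^(l)⟩` for `l > 0`. -/
def powT (T : TNorm) (α : IFV) (l : ℝ) : IFV where
  mu := T.pow α.mu l
  nu := T.dual.pow α.nu l
  add_le_one := by
    rw [add_le_one_iff_le_symm, unitInterval.le_symm_comm]
    refine (T.dual_pow_le _ _).trans (unitInterval.symm_le_symm.2 (T.pow_mono ?_ l))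
    rw [← add_le_one_iff_le_symm]; exact α.add_le_one

/-- The iterated operation `a₀ * a₁ * ⋯ * aₙ`, associated to the left. -/
def iterate (op : IFV → IFV → IFV) : (n : ℕ) → (Fin (n + 1) → IFV) → IFV
  | 0, a => a 0
  | n + 1, a => op (iterate op n fun i => a i.castSucc) (a (Fin.last (n + 1)))

/-- The weighted average `(ω₁)_T γ₁ ⊕_T ⋯ ⊕_T (ωₙ)_T γₙ`. -/
def IFWA (T : TNorm) {n : ℕ} (ω : Fin (n + 1) → ℝ) (γ : Fin (n + 1) → IFV) : IFV :=
  iterate (oplus T) n fun i => smulT T (ω i) (γ i)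

/-- The weighted geometric operator `γ₁^(ω₁)_T ⊗_T ⋯ ⊗_T γₙ^(ωₙ)_T`. -/
def IFWG (T : TNorm) {n : ℕ} (ω : Fin (n + 1) → ℝ) (γ : Fin (n + 1) → IFV) : IFV :=
  iterate (otimes T) n fun i => powT T (γ i) (ω i)

/-- `γ⁻ = ⟨min μ, max ν⟩`. -/
def lower {n : ℕ} (γ : Fin (n + 1) → IFV) : IFV where
  mu := Finset.univ.inf' Finset.univ_nonempty fun j => (γ j).mu
  nu := Finset.univ.sup' Finset.univ_nonempty fun j => (γ j).nu
  add_le_one := by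
    obtain ⟨j, -, hj⟩ := Finset.exists_mem_eq_sup' Finset.univ_nonempty fun j => (γ j).nu
    rw [hj, add_le_one_iff_le_symm]
    refine (Finset.inf'_le _ (Finset.mem_univ j)).trans ?_
    rw [← add_le_one_iff_le_symm]; exact (γ j).add_le_one

/-- `γ⁺ = ⟨max μ, min ν⟩`. -/
def upper {n : ℕ} (γ : Fin (n + 1) → IFV) : IFV where
  mu := Finset.univ.sup' Finset.univ_nonempty fun j => (γ j).mu
  nu := Finset.univ.inf' Finset.univ_nonempty fun j => (γ j).nu
  add_le_one := by
    obtain ⟨j, -, hj⟩ := Finset.exists_mem_eq_sup' Finset.univ_nonempty fun j => (γ j).mu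
    rw [hj, add_le_one_iff_le_symm, unitInterval.le_symm_comm]
    refine (Finset.inf'_le _ (Finset.mem_univ j)).trans ?_
    rw [unitInterval.le_symm_comm, ← add_le_one_iff_le_symm]; exact (γ j).add_le_one

end IFV

end

/-! Everything follows from the exponent law `pow_add` together with `pow_one`: the average of a
constant family has the power with exponent `∑ ω i = 1` in each component, which gives idempotency.
All operations are monotone for `CompLE`, so comparison with the constant families `lower γ` and
`upper γ` gives boundedness, and `CompLE` implies `XuLE`.

For rational exponents, continuity makes the `p`-th root an exact right inverse of the `p`-th power,
so common denominators reduce the law to natural powers. For real exponents, one inequality moves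
infima through the continuous `T`. The other meets an obstacle: a rational `r ≤ a + b` need not
split into rationals below `a` and `b`. Every rational `s < r` does, up to enlarging it, and left
continuity in the exponent (`le_ratPow_of_forall_lt`) passes from `s` to `r`. The conorm statements
follow by duality. -/

namespace TNorm

variable (T : TNorm)

theorem op_one (x : I) : T.op x 1 = x := T.neutral x

theorem op_le_left (x y : I) : T.op x y ≤ x :=
  (T.op_le_op le_rfl unitInterval.le_one').trans_eq (T.neutral x)

theorem op_le_right (x y : I) : T.op x y ≤ y := by
  rw [T.comm]; exact T.op_le_left y x

theorem op_zero (x : I) : T.op x 0 = 0 :=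
  le_antisymm (T.op_le_right x 0) unitInterval.nonneg'

variable {T}

theorem IsContinuous.continuous_right (hT : T.IsContinuous) (x : I) :
    Continuous fun y => T.op x y :=
  hT.comp (continuous_const.prodMk continuous_id)

theorem IsContinuous.continuous_natPow (hT : T.IsContinuous) (m : ℕ) :
    Continuous fun x => T.natPow x m := by
  induction m with
  | zero => exact continuous_const
  | succ m ih => exact hT.comp (ih.prodMk continuous_id)

variable (T)

theorem one_natPow (m : ℕ) : T.natPow 1 m = 1 := by
  induction m with
  | zero => rfl
  | succ m ih => rw [natPow, ih, T.neutral]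

theorem zero_natPow {m : ℕ} (hm : m ≠ 0) : T.natPow 0 m = 0 := by
  obtain ⟨k, rfl⟩ := Nat.exists_eq_succ_of_ne_zero hm
  exact T.op_zero _

theorem natPow_add (x : I) (a b : ℕ) :
    T.natPow x (a + b) = T.op (T.natPow x a) (T.natPow x b) := by
  induction b with
  | zero => exact (T.neutral _).symm
  | succ b ih => rw [← add_assoc, natPow, ih, natPow, T.assoc]

theorem natPow_mul (x : I) (a b : ℕ) : T.natPow x (a * b) = T.natPow (T.natPow x a) b := by
  induction b with
  | zero => rfl
  | succ b ih => rw [Nat.mul_succ, natPow_add, ih, natPow]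

variable {T}

/-! ### Roots and rational powers -/

theorem natPow_surjective (hT : T.IsContinuous) {p : ℕ} (hp : p ≠ 0) :
    Function.Surjective fun v => T.natPow v p := fun u =>
  mem_range_of_exists_le_of_exists_ge (hT.continuous_natPow p)
    ⟨0, by simp [T.zero_natPow hp]⟩ ⟨1, by simpa [T.one_natPow] using unitInterval.le_one'⟩

theorem natPow_root (hT : T.IsContinuous) {p : ℕ} (hp : p ≠ 0) (u : I) :
    T.natPow (T.root p u) p = u := by
  have hmono : Monotone fun v => T.natPow v p := fun _ _ h => T.natPow_mono h p
  -- The value at `0` covers `u = 0`, where the set is empty and its supremum is `0`.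
  have h := hmono.map_sSup_of_continuousAt (s := {v | T.natPow v p < u})
    (hT.continuous_natPow p).continuousAt (T.zero_natPow hp)
  have himage : (fun v => T.natPow v p) '' {v | T.natPow v p < u} = Set.Iio u :=
    Set.image_preimage_eq (Set.Iio u) (natPow_surjective hT hp)
  rw [himage] at h
  exact h.trans isLUB_Iio.sSup_eq

/-- The `p`-th root is the lower adjoint of the `p`-th power. -/
theorem root_le_iff (hT : T.IsContinuous) {p : ℕ} (hp : p ≠ 0) {u v : I} :
    T.root p u ≤ v ↔ u ≤ T.natPow v p := by
  refine ⟨fun h => (natPow_root hT hp u).symm.trans_le (T.natPow_mono h p), fun h => ?_⟩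
  refine sSup_le fun w hw => le_of_not_ge fun hvw => ?_
  exact absurd (h.trans (T.natPow_mono hvw p)) (not_le_of_gt hw)

/-- Powers compose, hence so do their lower adjoints. -/
theorem root_mul (hT : T.IsContinuous) {k p : ℕ} (hk : k ≠ 0) (hp : p ≠ 0) (u : I) :
    T.root (k * p) u = T.root k (T.root p u) :=
  eq_of_forall_ge_iff fun v => by
    rw [root_le_iff hT (mul_ne_zero hk hp), root_le_iff hT hk, root_le_iff hT hp, natPow_mul]

/-- Rational powers may be computed from any fraction representing the exponent. -/
theorem ratPow_eq_of_mul_eq (hT : T.IsContinuous) (u : I) {r : ℚ≥0} {p q : ℕ} (hp : p ≠ 0)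
    (h : r * p = q) : T.ratPow u r = T.natPow (T.root p u) q := by
  have hcross : r.num * p = q * r.den := by
    have hden : (r.den : ℚ≥0) ≠ 0 := Nat.cast_ne_zero.2 r.den_ne_zero
    have hr : (r.num : ℚ≥0) = r * r.den := by
      rw [← div_eq_iff hden, NNRat.num_div_den]
    have : (r.num * p : ℚ≥0) = q * r.den := by rw [hr, ← h]; ring
    exact_mod_cast this
  obtain ⟨k, rfl⟩ : r.den ∣ p :=
    r.coprime_num_den.symm.dvd_of_dvd_mul_left (hcross ▸ Dvd.intro_left q rfl)
  have hq : q = k * r.num := by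
    refine Nat.eq_of_mul_eq_mul_right r.den_pos ?_
    rw [← hcross]; ring
  have hk : k ≠ 0 := right_ne_zero_of_mul hp
  -- The common factor `k` contributes a `k`-th root followed by a `k`-th power, which cancel.
  rw [hq, natPow_mul, mul_comm, root_mul hT hk r.den_ne_zero, natPow_root hT hk, ratPow]

theorem ratPow_one (hT : T.IsContinuous) (u : I) : T.ratPow u 1 = u := by
  rw [ratPow_eq_of_mul_eq hT u one_ne_zero (q := 1) (by simp), natPow_root hT one_ne_zero]

theorem ratPow_add (hT : T.IsContinuous) (u : I) (r s : ℚ≥0) :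
    T.ratPow u (r + s) = T.op (T.ratPow u r) (T.ratPow u s) := by
  have hp : r.den * s.den ≠ 0 := mul_ne_zero r.den_ne_zero s.den_ne_zero
  have hr : r * (r.den * s.den : ℕ) = (r.num * s.den : ℕ) := by
    push_cast; rw [← mul_assoc, NNRat.mul_den_eq_num]
  have hs : s * (r.den * s.den : ℕ) = (s.num * r.den : ℕ) := by
    push_cast; rw [mul_left_comm, NNRat.mul_den_eq_num, mul_comm]
  rw [ratPow_eq_of_mul_eq hT u hp hr, ratPow_eq_of_mul_eq hT u hp hs, ← natPow_add]
  refine ratPow_eq_of_mul_eq hT u hp ?_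
  rw [add_mul, hr, hs, Nat.cast_add]

theorem ratPow_antitone (hT : T.IsContinuous) (u : I) : Antitone (T.ratPow u) := by
  intro r s h
  obtain ⟨d, rfl⟩ := exists_add_of_le h
  rw [ratPow_add hT]
  exact T.op_le_left _ _

/-- An idempotent element of a continuous t-norm acts as a unit on everything below it. -/
theorem op_eq_left_of_le_of_idempotent (hT : T.IsContinuous) {e w : I} (he : T.op e e = e)
    (h : w ≤ e) : T.op w e = w := by
  -- By the intermediate value theorem, as `T.op e` runs from `0` to `e`; the factor `e` in `w` then
  -- absorbs another `e`.
  obtain ⟨x, rfl⟩ : ∃ x, T.op e x = w :=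
    mem_range_of_exists_le_of_exists_ge (hT.continuous_right e)
      ⟨0, by simp [T.op_zero]⟩ ⟨1, by simpa [T.op_one] using h⟩
  rw [T.comm (T.op e x) e, T.assoc, he]

/-- Left continuity of the rational powers in the exponent. -/
theorem le_ratPow_of_forall_lt (hT : T.IsContinuous) {u w : I} {r : ℚ≥0} (hr : 0 < r)
    (h : ∀ s < r, w ≤ T.ratPow u s) : w ≤ T.ratPow u r := by
  set A : Set I := T.ratPow u '' Set.Ioi 0
  -- Halving the exponent writes each member of `A` as the square of another.
  have hidem : T.op (sSup A) (sSup A) = sSup A := by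
    refine le_antisymm (T.op_le_left _ _) (sSup_le ?_)
    rintro _ ⟨s, hs, rfl⟩
    have hs2 : T.ratPow u (s / 2) ≤ sSup A := le_sSup ⟨s / 2, half_pos (Set.mem_Ioi.1 hs), rfl⟩
    calc T.ratPow u s = T.op (T.ratPow u (s / 2)) (T.ratPow u (s / 2)) := by
          rw [← ratPow_add hT, add_halves]
      _ ≤ _ := T.op_le_op hs2 hs2
  have hw : w ≤ sSup A := (h _ (half_lt_self hr)).trans (le_sSup ⟨r / 2, half_pos hr, rfl⟩)
  have hmono : Monotone fun y => T.op w y := fun _ _ h => T.op_le_op le_rfl h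
  -- Now `w` is the supremum of `T.op w (T.ratPow u s)` over `s > 0`; for `s ≤ r`, the bound `w ≤
  -- T.ratPow u (r - s)` suffices.
  rw [← op_eq_left_of_le_of_idempotent hT hidem hw,
    hmono.map_sSup_of_continuousAt (hT.continuous_right w).continuousAt (T.op_zero w)]
  refine sSup_le ?_
  rintro _ ⟨_, ⟨s, hs, rfl⟩, rfl⟩
  rcases le_total r s with hrs | hsr
  · exact (T.op_le_right _ _).trans (ratPow_antitone hT u hrs)
  · calc T.op w (T.ratPow u s) ≤ T.op (T.ratPow u (r - s)) (T.ratPow u s) :=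
          T.mono _ _ _ (h _ (tsub_lt_self hr hs))
      _ = T.ratPow u r := by rw [← ratPow_add hT, tsub_add_cancel_of_le hsr]

/-! ### Real powers -/

theorem pow_le_ratPow (u : I) {t : ℝ} {r : ℚ≥0} (h : (r : ℝ) ≤ t) : T.pow u t ≤ T.ratPow u r :=
  sInf_le ⟨r, h, rfl⟩

theorem pow_one (hT : T.IsContinuous) (u : I) : T.pow u 1 = u := by
  refine le_antisymm ((pow_le_ratPow u (by simp)).trans_eq (ratPow_one hT u)) (le_sInf ?_)
  rintro _ ⟨r, hr, rfl⟩
  exact (ratPow_one hT u).symm.trans_le (ratPow_antitone hT u (by exact_mod_cast hr))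

/-- Continuity and monotonicity move the infimum out of `T.op v`; the exponent `0` keeps the set
nonempty. -/
theorem le_op_pow (hT : T.IsContinuous) {u v w : I} {t : ℝ} (ht : 0 ≤ t)
    (h : ∀ r : ℚ≥0, (r : ℝ) ≤ t → w ≤ T.op v (T.ratPow u r)) : w ≤ T.op v (T.pow u t) := by
  have hmono : Monotone fun y => T.op v y := fun _ _ h => T.op_le_op le_rfl h
  have hne : {x : I | ∃ r : ℚ≥0, (r : ℝ) ≤ t ∧ x = T.ratPow u r}.Nonempty :=
    ⟨_, 0, by simpa using ht, rfl⟩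
  rw [pow, hmono.map_csInf_of_continuousAt (hT.continuous_right v).continuousAt hne]
  refine le_sInf ?_
  rintro _ ⟨_, ⟨r, hr, rfl⟩, rfl⟩
  exact h r hr

theorem pow_add (hT : T.IsContinuous) (u : I) {a b : ℝ} (ha : 0 < a) (hb : 0 < b) :
    T.pow u (a + b) = T.op (T.pow u a) (T.pow u b) := by
  apply le_antisymm
  · refine le_op_pow hT hb.le fun s hs => ?_
    rw [T.comm]
    refine le_op_pow hT ha.le fun r hr => ?_
    rw [← ratPow_add hT]
    refine pow_le_ratPow u ?_
    push_cast
    linarith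
  · refine le_sInf ?_
    rintro _ ⟨r, hr, rfl⟩
    rcases eq_zero_or_pos r with rfl | hr0
    · exact unitInterval.le_one'
    refine le_ratPow_of_forall_lt hT hr0 fun s hs => ?_
    have hs' : (s : ℝ) < a + b := lt_of_lt_of_le (by exact_mod_cast hs) hr
    -- A rational `c` in `(max (s - b) 0, a)` leaves a remainder `s - c ≤ b`. The subtraction is
    -- truncated, so `c + (s - c)` may exceed `s`; antitonicity absorbs this.
    obtain ⟨c, hc, hca⟩ := exists_rat_btwn (max_lt (sub_lt_iff_lt_add.2 hs') ha)
    obtain ⟨hsc, hc0⟩ := max_lt_iff.1 hc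
    lift c to ℚ≥0 using by exact_mod_cast hc0.le
    norm_cast at hsc hca
    have hd : ((s - c : ℚ≥0) : ℝ) ≤ b := by
      rcases le_total c s with hcs | hsc'
      · obtain ⟨d, rfl⟩ := exists_add_of_le hcs
        rw [add_tsub_cancel_left]
        push_cast at hsc
        linarith
      · rw [tsub_eq_zero_of_le hsc']; simpa using hb.le
    calc T.op (T.pow u a) (T.pow u b) ≤ T.op (T.ratPow u c) (T.ratPow u (s - c)) :=
          T.op_le_op (pow_le_ratPow u hca.le) (pow_le_ratPow u hd)
      _ = T.ratPow u (c + (s - c)) := (ratPow_add hT u _ _).symm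
      _ ≤ T.ratPow u s := ratPow_antitone hT u le_add_tsub

/-! ### Transfer to the dual conorm -/

theorem dual_op (x y : I) : T.dual.op x y = σ (T.op (σ x) (σ y)) := rfl

theorem dual_pow (u : I) (t : ℝ) : T.dual.pow u t = σ (T.pow (σ u) t) := by
  refine le_antisymm (T.dual_pow_le u t) ?_
  rw [unitInterval.symm_le_comm]
  refine le_sInf ?_
  rintro _ ⟨r, hr, rfl⟩
  rw [unitInterval.symm_le_comm, ← dual_ratPow]
  exact le_sSup ⟨r, hr, rfl⟩

theorem dual_pow_one (hT : T.IsContinuous) (u : I) : T.dual.pow u 1 = u := by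
  rw [dual_pow, pow_one hT, unitInterval.symm_symm]

theorem dual_pow_add (hT : T.IsContinuous) (u : I) {a b : ℝ} (ha : 0 < a) (hb : 0 < b) :
    T.dual.pow u (a + b) = T.dual.op (T.dual.pow u a) (T.dual.pow u b) := by
  simp only [dual_pow, dual_op, unitInterval.symm_symm, pow_add hT _ ha hb]

theorem dual_op_le_op {x x' y y' : I} (hx : x ≤ x') (hy : y ≤ y') :
    T.dual.op x y ≤ T.dual.op x' y' :=
  unitInterval.symm_le_symm.2
    (T.op_le_op (unitInterval.symm_le_symm.2 hx) (unitInterval.symm_le_symm.2 hy))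

theorem dual_pow_mono {x y : I} (h : x ≤ y) (t : ℝ) : T.dual.pow x t ≤ T.dual.pow y t := by
  rw [dual_pow, dual_pow, unitInterval.symm_le_symm]
  exact T.pow_mono (unitInterval.symm_le_symm.2 h) t

end TNorm

/-! ### Intuitionistic fuzzy values -/

namespace IFV

variable {T : TNorm}

/-- Unless both components agree, the score increases strictly, so the accuracy tie-break never
occurs. -/
theorem CompLE.xuLE {α β : IFV} (h : α.CompLE β) : α.XuLE β := by
  obtain ⟨hmu, hnu⟩ := h
  have hmu' : (α.mu : ℝ) ≤ β.mu := hmu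
  have hnu' : (β.nu : ℝ) ≤ α.nu := hnu
  by_cases h : α = β
  · exact Or.inr h
  refine Or.inl (Or.inl (lt_of_not_ge fun hscore => h ?_))
  simp only [score] at hscore
  exact IFV.ext (Subtype.ext (by linarith)) (Subtype.ext (by linarith))

theorem CompLE.oplus {α α' β β' : IFV} (hα : α.CompLE α') (hβ : β.CompLE β') :
    (α.oplus T β).CompLE (α'.oplus T β') :=
  ⟨TNorm.dual_op_le_op hα.1 hβ.1, T.op_le_op hα.2 hβ.2⟩

theorem CompLE.otimes {α α' β β' : IFV} (hα : α.CompLE α') (hβ : β.CompLE β') :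
    (α.otimes T β).CompLE (α'.otimes T β') :=
  ⟨T.op_le_op hα.1 hβ.1, TNorm.dual_op_le_op hα.2 hβ.2⟩

theorem CompLE.smulT {α β : IFV} (h : α.CompLE β) (l : ℝ) :
    (α.smulT T l).CompLE (β.smulT T l) :=
  ⟨TNorm.dual_pow_mono h.1 l, T.pow_mono h.2 l⟩

theorem CompLE.powT {α β : IFV} (h : α.CompLE β) (l : ℝ) :
    (α.powT T l).CompLE (β.powT T l) :=
  ⟨T.pow_mono h.1 l, TNorm.dual_pow_mono h.2 l⟩

theorem CompLE.iterate {op : IFV → IFV → IFV}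
    (hop : ∀ {α α' β β' : IFV}, α.CompLE α' → β.CompLE β' → (op α β).CompLE (op α' β')) {n : ℕ}
    {a b : Fin (n + 1) → IFV} (h : ∀ i, (a i).CompLE (b i)) :
    (iterate op n a).CompLE (iterate op n b) := by
  induction n with
  | zero => exact h 0
  | succ n ih => exact hop (ih fun i => h i.castSucc) (h _)

theorem CompLE.IFWA {n : ℕ} {γ β : Fin (n + 1) → IFV} (h : ∀ i, (γ i).CompLE (β i))
    (ω : Fin (n + 1) → ℝ) : (IFWA T ω γ).CompLE (IFWA T ω β) :=
  CompLE.iterate CompLE.oplus fun i => (h i).smulT (ω i)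

theorem CompLE.IFWG {n : ℕ} {γ β : Fin (n + 1) → IFV} (h : ∀ i, (γ i).CompLE (β i))
    (ω : Fin (n + 1) → ℝ) : (IFWG T ω γ).CompLE (IFWG T ω β) :=
  CompLE.iterate CompLE.otimes fun i => (h i).powT (ω i)

theorem lower_compLE {n : ℕ} (γ : Fin (n + 1) → IFV) (i : Fin (n + 1)) :
    (lower γ).CompLE (γ i) :=
  ⟨Finset.inf'_le (fun j => (γ j).mu) (Finset.mem_univ i),
    Finset.le_sup' (fun j => (γ j).nu) (Finset.mem_univ i)⟩

theorem compLE_upper {n : ℕ} (γ : Fin (n + 1) → IFV) (i : Fin (n + 1)) :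
    (γ i).CompLE (upper γ) :=
  ⟨Finset.le_sup' (fun j => (γ j).mu) (Finset.mem_univ i),
    Finset.inf'_le (fun j => (γ j).nu) (Finset.mem_univ i)⟩

/-- Iterating an operation along an additive family evaluates the family at the sum. -/
theorem iterate_of_map_add {op : IFV → IFV → IFV} {f : ℝ → IFV}
    (hf : ∀ {a b : ℝ}, 0 < a → 0 < b → f (a + b) = op (f a) (f b)) {n : ℕ}
    {ω : Fin (n + 1) → ℝ} (hω : ∀ i, 0 < ω i) :
    iterate op n (fun i => f (ω i)) = f (∑ i, ω i) := by
  induction n with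
  | zero => simp [iterate]
  | succ n ih =>
    -- The additive law is only assumed for positive arguments, so the partial sum must be shown
    -- positive.
    rw [Fin.sum_univ_castSucc, hf (Finset.sum_pos (fun i _ => hω _) Finset.univ_nonempty) (hω _),
      ← ih fun i => hω i.castSucc, iterate]

theorem IFWA_const (hT : T.IsContinuous) {n : ℕ} {ω : Fin (n + 1) → ℝ} (hω : ∀ i, 0 < ω i)
    (hsum : ∑ i, ω i = 1) (γ₀ : IFV) : IFWA T ω (fun _ => γ₀) = γ₀ := by
  have h := iterate_of_map_add (op := oplus T) (f := fun l => smulT T l γ₀) (fun ha hb =>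
    IFV.ext (TNorm.dual_pow_add hT _ ha hb) (TNorm.pow_add hT _ ha hb)) hω
  rw [hsum] at h
  exact h.trans (IFV.ext (TNorm.dual_pow_one hT _) (TNorm.pow_one hT _))

theorem IFWG_const (hT : T.IsContinuous) {n : ℕ} {ω : Fin (n + 1) → ℝ} (hω : ∀ i, 0 < ω i)
    (hsum : ∑ i, ω i = 1) (γ₀ : IFV) : IFWG T ω (fun _ => γ₀) = γ₀ := by
  have h := iterate_of_map_add (op := otimes T) (f := powT T γ₀) (fun ha hb =>
    IFV.ext (TNorm.pow_add hT _ ha hb) (TNorm.dual_pow_add hT _ ha hb)) hω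
  rw [hsum] at h
  exact h.trans (IFV.ext (TNorm.pow_one hT _) (TNorm.dual_pow_one hT _))

end IFV

theorem mainTheorem10 (T : TNorm) (hT : T.IsContinuous) {n : ℕ} (ω : Fin (n + 1) → ℝ)
    (hω : ∀ i, ω i ∈ Set.Ioc (0 : ℝ) 1) (hsum : ∑ i, ω i = 1) (γ : Fin (n + 1) → IFV) :
    (∀ γ₀ : IFV, (∀ i, γ i = γ₀) → IFV.IFWA T ω γ = γ₀ ∧ IFV.IFWG T ω γ = γ₀) ∧
    ((IFV.lower γ).CompLE (IFV.IFWA T ω γ) ∧ (IFV.IFWA T ω γ).CompLE (IFV.upper γ) ∧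
      (IFV.lower γ).CompLE (IFV.IFWG T ω γ) ∧ (IFV.IFWG T ω γ).CompLE (IFV.upper γ)) ∧
    ((IFV.lower γ).XuLE (IFV.IFWA T ω γ) ∧ (IFV.IFWA T ω γ).XuLE (IFV.upper γ) ∧
      (IFV.lower γ).XuLE (IFV.IFWG T ω γ) ∧ (IFV.IFWG T ω γ).XuLE (IFV.upper γ)) ∧
    (∀ β : Fin (n + 1) → IFV,
      (∀ j, (γ j).mu ≤ (β j).mu) → (∀ j, (β j).nu ≤ (γ j).nu) →
        (IFV.IFWA T ω γ).XuLE (IFV.IFWA T ω β) ∧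
        (IFV.IFWG T ω γ).XuLE (IFV.IFWG T ω β)) := by
  have hpos : ∀ i, 0 < ω i := fun i => (hω i).1
  have hA : (IFV.lower γ).CompLE (IFV.IFWA T ω γ) ∧ (IFV.IFWA T ω γ).CompLE (IFV.upper γ) := by
    have h₁ := IFV.CompLE.IFWA (T := T) (IFV.lower_compLE γ) ω
    have h₂ := IFV.CompLE.IFWA (T := T) (IFV.compLE_upper γ) ω
    rw [IFV.IFWA_const hT hpos hsum] at h₁ h₂
    exact ⟨h₁, h₂⟩
  have hG : (IFV.lower γ).CompLE (IFV.IFWG T ω γ) ∧ (IFV.IFWG T ω γ).CompLE (IFV.upper γ) := by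
    have h₁ := IFV.CompLE.IFWG (T := T) (IFV.lower_compLE γ) ω
    have h₂ := IFV.CompLE.IFWG (T := T) (IFV.compLE_upper γ) ω
    rw [IFV.IFWG_const hT hpos hsum] at h₁ h₂
    exact ⟨h₁, h₂⟩
  refine ⟨fun γ₀ h => ?_, ⟨hA.1, hA.2, hG⟩,
    ⟨hA.1.xuLE, hA.2.xuLE, hG.1.xuLE, hG.2.xuLE⟩, fun β hmu hnu => ?_⟩
  · obtain rfl : γ = fun _ => γ₀ := funext h
    exact ⟨IFV.IFWA_const hT hpos hsum γ₀, IFV.IFWG_const hT hpos hsum γ₀⟩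
  · have h : ∀ i, (γ i).CompLE (β i) := fun i => ⟨hmu i, hnu i⟩
    exact ⟨(IFV.CompLE.IFWA h ω).xuLE, (IFV.CompLE.IFWG h ω).xuLE⟩
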